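/- Let $(W,S)$ be a Coxeter system with $W$ finite and length function $l$. Let $\Gamma$ be an abelian group (written additively) with a total order compatible with addition, and let $L\colon W\to\Gamma$ be a weight function, i.e. $L(ww')=L(w)+L(w')$ whenever $l(ww')=l(w)+l(w')$, such that $L(s)>0$ for all $s\in S$. Let $R\subseteq\mathbb C$ be a subring containing $2\cos(2\pi/m_{st})$ for all $s,t\in S$, where $m_{st}$ is the order of $st$. Let $F$ be the field of fractions of $R$, let $A=R[\Gamma]$ be the group ring with $R$-basis $\{\varepsilon^g\mid g\in\Gamma\}$, and let $K$ be the field of fractions of $A$. Let $\mathbf H$ be the generic Iwahori–Hecke algebra over $A$, with basis $\{T_w\mid w\in W\}$, identity element $T_1$, and multiplication $$T_sT_w=\begin{cases}T_{sw}&\text{if } l(sw)>l(w),\\ T_{sw}+(\varepsilon^{L(s)}-\varepsilon^{-L(s)})T_w&\text{if } l(sw)<l(w),\end{cases}\qquad s\in S,\ w\in W,$$ and put $\mathbf H_K=K\otimes_A\mathbf H$. Every $0\neq x\in K$ can be written as $x=r_x\varepsilon^{g_x}(1+p)/(1+q)$ with $p,q$ in $F[\Gamma_{>0}]$ (the $F$-span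 of all $\varepsilon^g$ with $g>0$), where $0\neq r_x\in F$ and $g_x\in\Gamma$ are uniquely determined. Let $\mathcal O=\{0\}\cup\{x\neq0\mid g_x\ge 0\}$ and $\mathfrak p=\{0\}\cup\{x\neq 0\mid g_x>0\}$; the constant term of $x\in\mathcal O$ is the unique $r\in F$ with $x-r\in\mathfrak p$. Let $\{E^\lambda_\varepsilon\mid\lambda\in\Lambda\}$ be a complete set of representatives of the isomorphism classes of irreducible representations of $\mathbf H_K$, and let $d_\lambda=\dim E^\lambda_\varepsilon$. Define $\boldsymbol c_\lambda$ by $$\sum_{w\in W}\operatorname{trace}(T_w,E^\lambda_\varepsilon)\operatorname{trace}(T_{w^{-1}},E^\lambda_\varepsilon)=d_\lambda\boldsymbol c_\lambda,$$ and define $\boldsymbol a_\lambda\in\Gamma$ and $0\ne f_\lambda\in F$ by the condition that $\boldsymbol c_\lambda=f_\lambda\varepsilon^{-2\boldsymbol a_\lambda}+{}$a combination of terms $\varepsilon^g$ with $g>-2\boldsymbol a_\lambda$. For each $\lambda\in\Lambda$ let $\rho^\lambda\colon\mathbf H_K\to M_{d_\lambda}(K)$ be a matrix representation afforded by $E^\lambda_\varepsilon$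 which is balanced, i.e. $\varepsilon^{\boldsymbol a_\lambda}\rho^\lambda_{ij}(T_w)\in\mathcal O$ for all $w,i,j$, and let the leading matrix coefficient $c^{ij}_{w,\lambda}\in F$ be the constant term of $(-1)^{l(w)}\varepsilon^{\boldsymbol a_\lambda}\rho^\lambda_{ij}(T_w)$. For $x,y,z\in W$ set $$\tilde\gamma_{x,y,z}=\sum_{\lambda\in\Lambda}\ \sum_{1\le i,j,k\le d_\lambda}f_\lambda^{-1}\,c^{ij}_{x,\lambda}\,c^{jk}_{y,\lambda}\,c^{ki}_{z,\lambda},$$ and let $\tilde{\mathbf J}$ be the $F$-vector space with basis $\{t_w\mid w\in W\}$ and bilinear product $t_xt_y=\sum_{z\in W}\tilde\gamma_{x,y,z^{-1}}\,t_z$. **Proposition 3.8.** The linear map $\tilde{\mathbf J}\to\tilde{\mathbf J}$ with $t_w\mapsto t_{w^{-1}}$ is an anti-involution: applied twice it is the identity, and it reverses products. That is, $\tilde\gamma_{x,y,z}=\tilde\gamma_{y^{-1},x^{-1},z^{-1}}$ for all $x,y,z\in W$. -/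

import Mathlib

namespace GeckHecke

noncomputable section

/-! ### Coefficient rings -/

/-- The ring `ℤ_W = ℤ[2 cos (2π / m_st) | s, t ∈ S]`, where `m_st` is the order of `s t` in `W`. -/
def cosRing {B W : Type*} [Group W] {M : CoxeterMatrix B} (cs : CoxeterSystem M W) : Subring ℂ :=
  Subring.closure {x : ℂ | ∃ i j : B,
    x = ((2 * Real.cos (2 * Real.pi / (orderOf (cs.simple i * cs.simple j) : ℝ)) : ℝ) : ℂ)}

/-- A weight function `L : W → Γ`. -/
def IsWeightFunction {B W Γ : Type*} [Group W] [AddCommGroup Γ] {M : CoxeterMatrix B}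
    (cs : CoxeterSystem M W) (L : W → Γ) : Prop :=
  ∀ w w' : W, cs.length (w * w') = cs.length w + cs.length w' → L (w * w') = L w + L w'

/-- The group ring `A = R[Γ]`. (The ring `R` will be a subring of `ℂ`.) -/
abbrev Coeff (R : Type*) [CommRing R] (Γ : Type*) [AddCommGroup Γ] : Type _ := AddMonoidAlgebra R Γ

/-- The field of fractions `F` of `R`. -/
abbrev BaseField (R : Type*) [CommRing R] : Type _ := FractionRing R

/-- The field of fractions `K` of `A = R[Γ]`. -/
abbrev GenField (R : Type*) [CommRing R] (Γ : Type*) [AddCommGroup Γ] : Type _ :=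
  FractionRing (Coeff R Γ)

/-! ### The generic Iwahori--Hecke algebra -/

section Hecke

variable {B W Γ : Type*} [Group W] [AddCommGroup Γ] {M : CoxeterMatrix B}

/-- The defining relations: `T_1` is the identity element, and the multiplication rule for
`T_s T_w`, where `v_s = ε ^ L(s)`. -/
inductive HeckeRel (cs : CoxeterSystem M W) (R : Type*) [CommRing R] (L : W → Γ) :
    FreeAlgebra (Coeff R Γ) W → FreeAlgebra (Coeff R Γ) W → Prop
  | one : HeckeRel cs R L (FreeAlgebra.ι _ 1) 1
  | up (i : B) (w : W) (h : cs.length w < cs.length (cs.simple i * w)) :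
      HeckeRel cs R L (FreeAlgebra.ι _ (cs.simple i) * FreeAlgebra.ι _ w)
        (FreeAlgebra.ι _ (cs.simple i * w))
  | down (i : B) (w : W) (h : cs.length (cs.simple i * w) < cs.length w) :
      HeckeRel cs R L (FreeAlgebra.ι _ (cs.simple i) * FreeAlgebra.ι _ w)
        (FreeAlgebra.ι _ (cs.simple i * w) +
          ((AddMonoidAlgebra.single (L (cs.simple i)) 1 -
            AddMonoidAlgebra.single (-L (cs.simple i)) 1 : Coeff R Γ)) • FreeAlgebra.ι _ w)

/-- The generic Iwahori--Hecke algebra `H = H_A(W, S, L)` over `A = R[Γ]`: the associative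
`A`-algebra generated by the `T_w` (`w ∈ W`), which multiply according to the rule for `T_s T_w`.
(For a weight function `L` the `T_w` form an `A`-basis of this algebra.) -/
def Hecke (cs : CoxeterSystem M W) (R : Type*) [CommRing R] (L : W → Γ) : Type _ :=
  RingQuot (HeckeRel cs R L)

instance (cs : CoxeterSystem M W) (R : Type*) [CommRing R] (L : W → Γ) : Ring (Hecke cs R L) :=
  inferInstanceAs (Ring (RingQuot (HeckeRel cs R L)))

instance (cs : CoxeterSystem M W) (R : Type*) [CommRing R] (L : W → Γ) :
    Algebra (Coeff R Γ) (Hecke cs R L) :=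
  inferInstanceAs (Algebra (Coeff R Γ) (RingQuot (HeckeRel cs R L)))

/-- The element `T_w` of `H`. -/
def Hecke.T (cs : CoxeterSystem M W) (R : Type*) [CommRing R] (L : W → Γ) (w : W) : Hecke cs R L :=
  RingQuot.mkAlgHom (Coeff R Γ) (HeckeRel cs R L) (FreeAlgebra.ι _ w)

variable [LinearOrder Γ] [IsOrderedAddMonoid Γ]

/-- The `K`-algebra `H_K = K ⊗_A H`. -/
abbrev HeckeK (cs : CoxeterSystem M W) (R : Type*) [CommRing R] (L : W → Γ) : Type _ :=
  TensorProduct (Coeff R Γ) (GenField R Γ) (Hecke cs R L)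

/-- The element `T_w` of `H_K`. -/
def HeckeK.T (cs : CoxeterSystem M W) (R : Type*) [CommRing R] (L : W → Γ) (w : W) : HeckeK cs R L :=
  TensorProduct.tmul (Coeff R Γ) 1 (Hecke.T cs R L w)

end Hecke

/-! ### The valuation ring `𝒪` of `K` and constant terms -/

section Valuation

variable (R : Type*) [CommRing R] [IsDomain R] (Γ : Type*) [AddCommGroup Γ] [LinearOrder Γ]
  [IsOrderedAddMonoid Γ]

/-- The embedding `F → K` extending `R → A → K`. -/
def baseToGen : BaseField R →+* GenField R Γ :=
  IsFractionRing.lift (A := R) (K := BaseField R)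
    (g := (algebraMap (Coeff R Γ) (GenField R Γ)).comp (algebraMap R (Coeff R Γ)))
    ((IsFractionRing.injective (Coeff R Γ) (GenField R Γ)).comp
      (FaithfulSMul.algebraMap_injective R (Coeff R Γ)))

variable {Γ}

/-- The element `ε ^ g` of `K`. -/
def eps (g : Γ) : GenField R Γ :=
  algebraMap (Coeff R Γ) (GenField R Γ) (AddMonoidAlgebra.single g 1)

variable {R}

/-- The element `∑_g a_g ε ^ g` of `K` given by an element of `F[Γ]`. -/
def polyToGen (a : AddMonoidAlgebra (BaseField R) Γ) : GenField R Γ :=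
  a.coeff.sum fun g r => baseToGen R Γ r * eps R g

/-- Membership in `F[Γ_{>0}]`. -/
def IsPositivePart (p : AddMonoidAlgebra (BaseField R) Γ) : Prop :=
  ∀ g ∈ p.coeff.support, 0 < g

/-- `x = r ε ^ g (1 + p) / (1 + q)` with `p, q ∈ F[Γ_{>0}]`. For `x ≠ 0`, this determines `r = r_x`
and `g = g_x`; for `x = 0`, it says that `r = 0`, with `g` arbitrary. -/
def HasLeading (x : GenField R Γ) (r : BaseField R) (g : Γ) : Prop :=
  ∃ p q : AddMonoidAlgebra (BaseField R) Γ, IsPositivePart p ∧ IsPositivePart q ∧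
    x = baseToGen R Γ r * eps R g * ((1 + polyToGen p) / (1 + polyToGen q))

/-- Membership in the valuation ring `𝒪 = {x ∈ K | g_x ≥ 0}` (where `g_0 = +∞`). -/
def MemO (x : GenField R Γ) : Prop :=
  x = 0 ∨ ∃ (r : BaseField R) (g : Γ), 0 ≤ g ∧ HasLeading x r g

/-- Membership in the maximal ideal `𝔭 = {x ∈ K | g_x > 0}` (where `g_0 = +∞`). -/
def MemP (x : GenField R Γ) : Prop :=
  x = 0 ∨ ∃ (r : BaseField R) (g : Γ), 0 < g ∧ HasLeading x r g

open Classical in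
/-- The constant term of `x ∈ 𝒪`: the element `r` of `F` with `x ≡ r` modulo `𝔭`
(by convention `0` if `x ∉ 𝒪`). -/
def constTerm (x : GenField R Γ) : BaseField R :=
  if h : ∃ r : BaseField R, MemP (x - baseToGen R Γ r) then h.choose else 0

/-- `c = f ε ^ (-2a) +` a combination of terms `ε ^ g` where `g > -2a`, with `f ≠ 0`. -/
def HasLowestTerm (c : GenField R Γ) (a : Γ) (f : BaseField R) : Prop :=
  f ≠ 0 ∧ ∃ s : AddMonoidAlgebra (BaseField R) Γ, (∀ g ∈ s.coeff.support, -(2 • a) < g) ∧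
    c = baseToGen R Γ f * eps R (-(2 • a)) + polyToGen s

end Valuation

/-! ### Matrix representations of `H_K` -/

section Representations

variable {B W Γ : Type*} [Group W] [AddCommGroup Γ] [LinearOrder Γ] [IsOrderedAddMonoid Γ]
  {M : CoxeterMatrix B}

/-- Matrix representations `H_K → M_n(K)`. -/
abbrev MatRep (cs : CoxeterSystem M W) (R : Type*) [CommRing R] [IsDomain R] (L : W → Γ) (n : ℕ) :
    Type _ :=
  HeckeK cs R L →ₐ[GenField R Γ] Matrix (Fin n) (Fin n) (GenField R Γ)

variable {cs : CoxeterSystem M W} {R : Type*} [CommRing R] [IsDomain R] {L : W → Γ}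

/-- Irreducibility: `K^n` is nonzero, and its only invariant subspaces are `0` and `K^n`. -/
def IsIrred {n : ℕ} (ρ : MatRep cs R L n) : Prop :=
  0 < n ∧ ∀ V : Submodule (GenField R Γ) (Fin n → GenField R Γ),
    (∀ h : HeckeK cs R L, ∀ v ∈ V, (ρ h).mulVec v ∈ V) → V = ⊥ ∨ V = ⊤

/-- Equivalence over `K` of matrix representations. -/
def IsEquivalent {m n : ℕ} (ρ : MatRep cs R L m) (σ : MatRep cs R L n) : Prop :=
  ∃ U : (Fin m → GenField R Γ) ≃ₗ[GenField R Γ] (Fin n → GenField R Γ),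
    ∀ (h : HeckeK cs R L) (v : Fin m → GenField R Γ), U ((ρ h).mulVec v) = (σ h).mulVec (U v)

/-- `ρ` is a family of matrix representations afforded by the irreducible representations of
`H_K`, one for each isomorphism class. -/
structure IsCompleteFamily {Λ : Type*} {d : Λ → ℕ} (ρ : ∀ l, MatRep cs R L (d l)) : Prop where
  irred : ∀ l, IsIrred (ρ l)
  inequivalent : ∀ l m, IsEquivalent (ρ l) (ρ m) → l = m
  exhaustive : ∀ (n : ℕ) (σ : MatRep cs R L n), IsIrred σ → ∃ l, IsEquivalent σ (ρ l)

variable [Fintype W]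

/-- The Schur element `c`, given by `∑_w trace(T_w) trace(T_{w⁻¹}) = n c`. -/
def schurElt {n : ℕ} (ρ : MatRep cs R L n) : GenField R Γ :=
  (n : GenField R Γ)⁻¹ *
    ∑ w : W, (ρ (HeckeK.T cs R L w)).trace * (ρ (HeckeK.T cs R L w⁻¹)).trace

open Classical in
/-- The invariant `a ∈ Γ`, given by `c = f ε ^ (-2a) + higher terms`. -/
def aInv {n : ℕ} (ρ : MatRep cs R L n) : Γ :=
  if h : ∃ a : Γ, ∃ f : BaseField R, HasLowestTerm (schurElt ρ) a f then h.choose else 0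

open Classical in
/-- The coefficient `f ∈ F`, given by `c = f ε ^ (-2a) + higher terms`. -/
def fInv {n : ℕ} (ρ : MatRep cs R L n) : BaseField R :=
  if h : ∃ f : BaseField R, ∃ a : Γ, HasLowestTerm (schurElt ρ) a f then h.choose else 0

/-- `ρ` is balanced: `ε ^ a ρ_ij(T_w) ∈ 𝒪` for all `w, i, j`. -/
def IsBalanced {n : ℕ} (ρ : MatRep cs R L n) : Prop :=
  ∀ (w : W) (i j : Fin n), MemO (eps R (aInv ρ) * ρ (HeckeK.T cs R L w) i j)

/-- The leading matrix coefficient `c_w^{ij}`: the constant term of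
`(-1)^{l(w)} ε ^ a ρ_ij(T_w)`. -/
def leadCoeff {n : ℕ} (ρ : MatRep cs R L n) (w : W) (i j : Fin n) : BaseField R :=
  constTerm ((-1) ^ cs.length w * eps R (aInv ρ) * ρ (HeckeK.T cs R L w) i j)

/-- The structure constants `γ̃_{x,y,z}`. -/
def gammaTilde {Λ : Type*} [Fintype Λ] {d : Λ → ℕ} (ρ : ∀ l, MatRep cs R L (d l))
    (x y z : W) : BaseField R :=
  ∑ l, ∑ i, ∑ j, ∑ k, (fInv (ρ l))⁻¹ * leadCoeff (ρ l) x i j * leadCoeff (ρ l) y j k *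
    leadCoeff (ρ l) z k i

/-! ### The algebra `J̃` -/

/-- The `F`-vector space `J̃` with basis `t_w` (`w ∈ W`). -/
abbrev JTilde (W : Type*) (R : Type*) [CommRing R] : Type _ := W →₀ BaseField R

/-- The basis element `t_w` of `J̃`. -/
def tBasis (R : Type*) [CommRing R] (w : W) : JTilde W R := Finsupp.single w 1

/-- The bilinear product on `J̃` with `t_x t_y = ∑_z γ̃_{x,y,z⁻¹} t_z`. -/
def jMul {Λ : Type*} [Fintype Λ] {d : Λ → ℕ} (ρ : ∀ l, MatRep cs R L (d l)) :
    JTilde W R →ₗ[BaseField R] JTilde W R →ₗ[BaseField R] JTilde W R :=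
  Finsupp.linearCombination (BaseField R) fun x : W =>
    Finsupp.linearCombination (BaseField R) fun y : W =>
      ∑ z : W, gammaTilde ρ x y z⁻¹ • tBasis R z

/-- The linear map `J̃ → J̃` with `t_w ↦ t_{w⁻¹}`. -/
def jFlip (W : Type*) [Group W] (R : Type*) [CommRing R] [IsDomain R] :
    JTilde W R →ₗ[BaseField R] JTilde W R :=
  Finsupp.linearCombination (BaseField R) fun w : W => tBasis R w⁻¹

end Representations

end

end GeckHecke

/-! The map `T_w ↦ T_{w⁻¹}` extends to an anti-automorphism of `H_K`. Composing a matrix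
representation with it and transposing gives the contragredient `MatRep.dual`. This operation is
involutive up to equality, preserves irreducibility and equivalence, and so permutes `Λ`
(`IsCompleteFamily.exists_dual_perm`). It also preserves Schur elements, hence `a` and `f`.

Constant terms respect sums and products on `𝒪`. So for a balanced `ρ` the sum over `i, j, k` in
`γ̃_{x,y,z}` is the constant term of `± ε^{3a} tr ρ(T_x T_y T_z)`, which depends only on the
character (`IsBalanced.sum_leadCoeff`). For the contragredient, transposition and cyclicity of the
trace turn `(x, y, z)` into `(y⁻¹, x⁻¹, z⁻¹)`. Reindexing the sum over `Λ` by the permutation gives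
the identity. Balanced representatives need not be dual to each other as matrices; only traces are
compared. -/

namespace GeckHecke

noncomputable section

open MulOpposite

/-! ### The anti-automorphism of the Hecke algebra. -/

section Flip

variable {B W Γ : Type*} [Group W] [AddCommGroup Γ] {M : CoxeterMatrix B}
  (cs : CoxeterSystem M W) (R : Type*) [CommRing R] (L : W → Γ)

/-- The element `ε ^ L(s) - ε ^ (-L(s))` of `A`. -/
def quadCoeff (i : B) : Coeff R Γ :=
  AddMonoidAlgebra.single (L (cs.simple i)) 1 - AddMonoidAlgebra.single (-L (cs.simple i)) 1

namespace Hecke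

theorem T_one : T cs R L 1 = 1 :=
  (RingQuot.mkAlgHom_rel (Coeff R Γ) (HeckeRel.one (cs := cs) (R := R) (L := L))).trans
    (map_one _)

theorem T_simple_mul_of_lt {i : B} {w : W} (h : cs.length w < cs.length (cs.simple i * w)) :
    T cs R L (cs.simple i) * T cs R L w = T cs R L (cs.simple i * w) :=
  (map_mul _ _ _).symm.trans
    (RingQuot.mkAlgHom_rel (Coeff R Γ) (HeckeRel.up (R := R) (L := L) i w h))

theorem T_simple_mul_of_gt {i : B} {w : W} (h : cs.length (cs.simple i * w) < cs.length w) :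
    T cs R L (cs.simple i) * T cs R L w =
      T cs R L (cs.simple i * w) + quadCoeff cs R L i • T cs R L w := by
  have := RingQuot.mkAlgHom_rel (Coeff R Γ) (HeckeRel.down (R := R) (L := L) i w h)
  rw [map_mul, map_add, map_smul] at this
  exact this

/-- `T_w` is multiplicative along reduced factorizations with a simple right factor. -/
theorem T_mul_simple_of_lt {w : W} {i : B} (h : cs.length w < cs.length (w * cs.simple i)) :
    T cs R L w * T cs R L (cs.simple i) = T cs R L (w * cs.simple i) := by
  induction hn : cs.length w generalizing w with
  | zero =>
    obtain rfl := cs.length_eq_zero_iff.mp hn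
    rw [T_one, one_mul, one_mul]
  | succ n ih =>
    have hw : w ≠ 1 := fun e => by simp [e] at hn
    -- Peel off a left descent `s_j`: `w = s_j u` is reduced, and so is `s_j (u s_i)`. Left
    -- multiplication by `T_{s_j}` then reduces the claim to `u`.
    obtain ⟨j, hj⟩ := cs.exists_leftDescent_of_ne_one hw
    obtain ⟨u, rfl⟩ : ∃ u, w = cs.simple j * u := ⟨cs.simple j * w, by simp⟩
    have hj' := cs.isLeftDescent_iff.mp hj
    rw [cs.simple_mul_simple_cancel_left] at hj'
    rw [mul_assoc] at h
    have h1 := cs.length_simple_mul (u * cs.simple i) j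
    have h2 := cs.length_mul_simple u i
    rw [← T_simple_mul_of_lt cs R L (by lia : cs.length u < cs.length (cs.simple j * u)),
      mul_assoc, ih (by lia) (by lia), mul_assoc,
      T_simple_mul_of_lt cs R L (by lia)]

/-- With `w = u s` reduced, `T_w T_s = T_u T_s²`, and the quadratic relation for `T_s` finishes. -/
theorem T_mul_simple_of_gt {w : W} {i : B} (h : cs.length (w * cs.simple i) < cs.length w) :
    T cs R L w * T cs R L (cs.simple i) =
      T cs R L (w * cs.simple i) + quadCoeff cs R L i • T cs R L w := by
  obtain ⟨u, rfl⟩ : ∃ u, w = u * cs.simple i := ⟨w * cs.simple i, by simp⟩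
  rw [cs.simple_mul_simple_cancel_right] at h ⊢
  have hs : T cs R L (cs.simple i) * T cs R L (cs.simple i) =
      1 + quadCoeff cs R L i • T cs R L (cs.simple i) := by
    rw [T_simple_mul_of_gt cs R L (by simp), cs.simple_mul_simple_self, T_one]
  rw [← T_mul_simple_of_lt cs R L h, mul_assoc, hs, mul_add, mul_one, mul_smul_comm]

/-- The anti-automorphism `T_w ↦ T_{w⁻¹}` of `H`. -/
def flip : Hecke cs R L →ₐ[Coeff R Γ] (Hecke cs R L)ᵐᵒᵖ :=
  RingQuot.liftAlgHom (Coeff R Γ)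
    ⟨FreeAlgebra.lift (Coeff R Γ) fun w => op (T cs R L w⁻¹), by
      rintro _ _ (_ | ⟨i, w, h⟩ | ⟨i, w, h⟩)
      · simp [T_one]
      · have h' : cs.length w⁻¹ < cs.length (w⁻¹ * cs.simple i) := by
          simpa [← cs.length_inv (cs.simple i * w)] using h
        simp [← op_mul, T_mul_simple_of_lt cs R L h']
      · have h' : cs.length (w⁻¹ * cs.simple i) < cs.length w⁻¹ := by
          simpa [← cs.length_inv (cs.simple i * w)] using h
        rw [map_mul, map_add, map_smul]
        simp only [FreeAlgebra.lift_ι_apply]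
        rw [← op_mul, cs.inv_simple, T_mul_simple_of_gt cs R L h', op_add, op_smul, mul_inv_rev,
          cs.inv_simple]
        rfl⟩

theorem flip_T (w : W) : flip cs R L (T cs R L w) = op (T cs R L w⁻¹) :=
  (RingQuot.liftAlgHom_mkAlgHom_apply _ _ _ _).trans (FreeAlgebra.lift_ι_apply _ _)

variable {cs R L}

theorem algHom_ext {C : Type*} [Ring C] [Algebra (Coeff R Γ) C]
    {f g : Hecke cs R L →ₐ[Coeff R Γ] C} (h : ∀ w, f (T cs R L w) = g (T cs R L w)) : f = g :=
  RingQuot.ringQuot_ext' (Coeff R Γ) f g (FreeAlgebra.hom_ext (funext h))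

end Hecke

end Flip

/-! ### Contragredient representations, equivalence and irreducibility. -/

section Dual

variable {B W Γ : Type*} [Group W] [AddCommGroup Γ] {M : CoxeterMatrix B}

theorem HeckeK.algHom_ext {cs : CoxeterSystem M W} {R : Type*} [CommRing R] {L : W → Γ}
    {C : Type*} [Ring C] [Algebra (GenField R Γ) C]
    {f g : HeckeK cs R L →ₐ[GenField R Γ] C}
    (h : ∀ w, f (HeckeK.T cs R L w) = g (HeckeK.T cs R L w)) : f = g := by
  -- Restriction of scalars along `A → K`, so that maps out of `K ⊗_A H` are determined on the two
  -- tensor factors.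
  let _ : Algebra (Coeff R Γ) C :=
    Algebra.compHom C (algebraMap (Coeff R Γ) (GenField R Γ))
  have : IsScalarTower (Coeff R Γ) (GenField R Γ) C := IsScalarTower.of_algebraMap_eq' rfl
  apply Algebra.TensorProduct.ext
  · ext
  · exact Hecke.algHom_ext h

variable (cs : CoxeterSystem M W) (R : Type*) [CommRing R] (L : W → Γ)

/-- The anti-automorphism `T_w ↦ T_{w⁻¹}` of `H_K`. -/
def HeckeK.flip : HeckeK cs R L →ₐ[GenField R Γ] (HeckeK cs R L)ᵐᵒᵖ :=
  Algebra.TensorProduct.lift (Algebra.ofId (GenField R Γ) (HeckeK cs R L)ᵐᵒᵖ)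
    ((AlgHom.op (Algebra.TensorProduct.includeRight :
      Hecke cs R L →ₐ[Coeff R Γ] HeckeK cs R L)).comp (Hecke.flip cs R L))
    fun _ _ => Algebra.commutes _ _

theorem HeckeK.flip_T (w : W) :
    HeckeK.flip cs R L (HeckeK.T cs R L w) = op (HeckeK.T cs R L w⁻¹) := by
  refine (Algebra.TensorProduct.lift_tmul _ _ _ _ _).trans ?_
  rw [map_one, one_mul, AlgHom.comp_apply, Hecke.flip_T]
  rfl

variable {cs R L} [IsDomain R]

namespace MatRep

/-- The contragredient `h ↦ ρ(h♭)ᵀ` of a matrix representation `ρ`, where `T_w♭ = T_{w⁻¹}`. -/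
def dual {n : ℕ} (ρ : MatRep cs R L n) : MatRep cs R L n :=
  (Matrix.transposeAlgEquiv (Fin n) (GenField R Γ) (GenField R Γ)).symm.toAlgHom.comp
    ((AlgHom.op ρ).comp (HeckeK.flip cs R L))

theorem dual_apply {n : ℕ} (ρ : MatRep cs R L n) (h : HeckeK cs R L) :
    dual ρ h = (ρ (HeckeK.flip cs R L h).unop).transpose := rfl

theorem dual_T {n : ℕ} (ρ : MatRep cs R L n) (w : W) :
    dual ρ (HeckeK.T cs R L w) = (ρ (HeckeK.T cs R L w⁻¹)).transpose := by
  rw [dual_apply, HeckeK.flip_T, unop_op]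

theorem dual_dual {n : ℕ} (ρ : MatRep cs R L n) : dual (dual ρ) = ρ :=
  HeckeK.algHom_ext fun w => by rw [dual_T, dual_T, inv_inv, Matrix.transpose_transpose]

theorem apply_eq_transpose_dual {n : ℕ} (ρ : MatRep cs R L n) (h : HeckeK cs R L) :
    ρ h = (dual ρ (HeckeK.flip cs R L h).unop).transpose := by
  rw [← dual_apply, dual_dual]

end MatRep

open Matrix

theorem isEquivalent_iff {m n : ℕ} {ρ : MatRep cs R L m} {σ : MatRep cs R L n} :
    IsEquivalent ρ σ ↔ ∃ (P : Matrix (Fin n) (Fin m) (GenField R Γ))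
      (Q : Matrix (Fin m) (Fin n) (GenField R Γ)), P * Q = 1 ∧ Q * P = 1 ∧
        ∀ h, P * ρ h = σ h * P := by
  constructor
  · rintro ⟨U, hU⟩
    refine ⟨LinearMap.toMatrix' U.toLinearMap, LinearMap.toMatrix' U.symm.toLinearMap, ?_, ?_, ?_⟩
    · rw [← LinearMap.toMatrix'_comp, U.comp_symm, LinearMap.toMatrix'_id]
    · rw [← LinearMap.toMatrix'_comp, U.symm_comp, LinearMap.toMatrix'_id]
    · intro h
      apply Matrix.toLin'.injective
      refine LinearMap.ext fun v => ?_
      simpa [Matrix.toLin'_mul] using hU h v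
  · rintro ⟨P, Q, h1, h2, h⟩
    refine ⟨Matrix.toLin'OfInv h2 h1, fun x v => ?_⟩
    change P *ᵥ (ρ x *ᵥ v) = σ x *ᵥ (P *ᵥ v)
    rw [Matrix.mulVec_mulVec, Matrix.mulVec_mulVec, h]

namespace IsEquivalent

variable {m n k : ℕ} {ρ : MatRep cs R L m} {σ : MatRep cs R L n} {τ : MatRep cs R L k}

theorem symm (h : IsEquivalent ρ σ) : IsEquivalent σ ρ := by
  obtain ⟨P, Q, h1, h2, h⟩ := isEquivalent_iff.mp h
  refine isEquivalent_iff.mpr ⟨Q, P, h2, h1, fun x => ?_⟩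
  calc Q * σ x = Q * (σ x * P) * Q := by simp only [Matrix.mul_assoc, h1, Matrix.mul_one]
    _ = ρ x * Q := by rw [← h, ← Matrix.mul_assoc, h2, Matrix.one_mul]

theorem trans (h : IsEquivalent ρ σ) (h' : IsEquivalent σ τ) : IsEquivalent ρ τ := by
  obtain ⟨U, hU⟩ := h
  obtain ⟨V, hV⟩ := h'
  exact ⟨U.trans V, fun x v => by simp [hU, hV]⟩

/-- Transposing `P ρ = σ P` gives an intertwiner in the opposite direction, hence the appeal to
`symm`. -/
theorem dual (h : IsEquivalent ρ σ) : IsEquivalent (MatRep.dual ρ) (MatRep.dual σ) := by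
  obtain ⟨P, Q, h1, h2, h⟩ := isEquivalent_iff.mp h
  refine symm (isEquivalent_iff.mpr ⟨Pᵀ, Qᵀ, ?_, ?_, fun x => ?_⟩)
  · rw [← Matrix.transpose_mul, h2, Matrix.transpose_one]
  · rw [← Matrix.transpose_mul, h1, Matrix.transpose_one]
  · rw [MatRep.dual_apply, MatRep.dual_apply, ← Matrix.transpose_mul, ← Matrix.transpose_mul, h]

theorem dim_eq (h : IsEquivalent ρ σ) : m = n := by
  obtain ⟨U, -⟩ := h
  simpa using U.finrank_eq

theorem trace_eq (h : IsEquivalent ρ σ) (x : HeckeK cs R L) : (ρ x).trace = (σ x).trace := by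
  obtain ⟨P, Q, h1, h2, h⟩ := isEquivalent_iff.mp h
  calc (ρ x).trace = (Q * (P * ρ x)).trace := by rw [← Matrix.mul_assoc, h2, Matrix.one_mul]
    _ = (σ x).trace := by
      rw [h, Matrix.trace_mul_comm, Matrix.mul_assoc, h1, Matrix.mul_one]

end IsEquivalent

variable [LinearOrder Γ] [IsOrderedAddMonoid Γ]

/-- The orthogonal complement `V'` of a `dual ρ`-stable subspace `V`, for the dot product, is
`ρ`-stable, so it is `0` or everything. -/
theorem IsIrred.dual {n : ℕ} {ρ : MatRep cs R L n} (hρ : IsIrred ρ) : IsIrred (MatRep.dual ρ) := by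
  refine ⟨hρ.1, fun V hV => ?_⟩
  let V' : Submodule (GenField R Γ) (Fin n → GenField R Γ) :=
    { carrier := {u | ∀ v ∈ V, v ⬝ᵥ u = 0}
      add_mem' := fun ha hb v hv => by rw [dotProduct_add, ha v hv, hb v hv, add_zero]
      zero_mem' := fun v _ => dotProduct_zero v
      smul_mem' := fun c x hx v hv => by rw [dotProduct_smul, hx v hv, smul_zero] }
  have hV' : ∀ h : HeckeK cs R L, ∀ u ∈ V', ρ h *ᵥ u ∈ V' := by
    intro h u hu v hv
    rw [MatRep.apply_eq_transpose_dual, Matrix.dotProduct_mulVec, Matrix.vecMul_transpose]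
    exact hu _ (hV _ v hv)
  rcases hρ.2 V' hV' with h | h
  · right
    -- A proper `V` is killed by a nonzero functional, that is, by the dot product with a nonzero
    -- vector of `V' = 0`.
    by_contra hne
    obtain ⟨f, hf, hle⟩ := V.exists_le_ker_of_lt_top (lt_top_iff_ne_top.mpr hne)
    obtain ⟨u, rfl⟩ := (dotProductEquiv (GenField R Γ) (Fin n)).surjective f
    have hu : u ∈ V' := fun v hv => by
      rw [dotProduct_comm]
      exact hle hv
    rw [h, Submodule.mem_bot] at hu
    exact hf (by rw [hu, map_zero])
  · left
    refine (Submodule.eq_bot_iff _).mpr fun v hv => dotProduct_eq_zero v fun u => ?_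
    have hu : u ∈ V' := h ▸ Submodule.mem_top
    exact hu v hv

end Dual

/-! ### Constant terms on the valuation ring. -/

section Residues

variable {R : Type*} [CommRing R] {Γ : Type*} [AddCommGroup Γ]

theorem eps_zero : eps R (0 : Γ) = 1 := map_one _

theorem eps_add (g h : Γ) : eps R (g + h) = eps R g * eps R h := by
  rw [eps, eps, eps, ← map_mul, AddMonoidAlgebra.single_mul_single, one_mul]

variable [LinearOrder Γ]

/-- Elements of `F[Γ_{≥0}]`. -/
def IsNonnegPart (a : AddMonoidAlgebra (BaseField R) Γ) : Prop :=
  ∀ g ∈ a.coeff.support, 0 ≤ g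

namespace IsNonnegPart

variable {a b : AddMonoidAlgebra (BaseField R) Γ}

theorem single {g : Γ} (hg : 0 ≤ g) (r : BaseField R) :
    IsNonnegPart (AddMonoidAlgebra.single g r) := by
  intro h hh
  rwa [Finset.mem_singleton.mp (Finsupp.support_single_subset hh)]

theorem add (ha : IsNonnegPart a) (hb : IsNonnegPart b) : IsNonnegPart (a + b) := by
  classical
  intro g hg
  exact (Finset.mem_union.mp (Finsupp.support_add hg)).elim (ha g) (hb g)

theorem isPositivePart_sub_one (ha : IsNonnegPart a)
    (h1 : a.coeff 0 = 1) : IsPositivePart (a - 1) := by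
  intro g hg
  rw [Finsupp.mem_support_iff, AddMonoidAlgebra.coeff_sub, Finsupp.sub_apply] at hg
  have hg0 : g ≠ 0 := by
    rintro rfl
    exact hg (by rw [h1, AddMonoidAlgebra.coeff_one_zero, sub_self])
  have h0 : (1 : AddMonoidAlgebra (BaseField R) Γ).coeff g = 0 := Finsupp.single_eq_of_ne hg0
  rw [h0, sub_zero] at hg
  exact lt_of_le_of_ne (ha g (Finsupp.mem_support_iff.mpr hg)) hg0.symm

variable [IsOrderedAddMonoid Γ]

theorem mul (ha : IsNonnegPart a) (hb : IsNonnegPart b) : IsNonnegPart (a * b) := by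
  classical
  intro g hg
  obtain ⟨x, hx, y, hy, rfl⟩ := Finset.mem_add.mp (AddMonoidAlgebra.support_coeff_mul_subset a b hg)
  exact add_nonneg (ha x hx) (hb y hy)

/-- Exponents `≥ 0` add up to `0` only as `0 + 0`. This is what makes constant terms multiplicative.
-/
theorem coeff_mul_zero (ha : IsNonnegPart a) (hb : IsNonnegPart b) :
    (a * b).coeff 0 = a.coeff 0 * b.coeff 0 := by
  have h := AddMonoidAlgebra.coeff_mul_add_of_uniqueAdd (f := a) (g := b) (a0 := 0) (b0 := 0)
    fun x y hx hy hxy => by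
      rw [add_zero] at hxy
      exact (add_eq_zero_iff_of_nonneg (ha x hx) (hb y hy)).mp hxy
  rwa [add_zero] at h

end IsNonnegPart

theorem IsPositivePart.coeff_zero {p : AddMonoidAlgebra (BaseField R) Γ}
    (hp : IsPositivePart p) : p.coeff 0 = 0 :=
  Finsupp.notMem_support_iff.mp fun h => (hp 0 h).false

variable [IsDomain R] [IsOrderedAddMonoid Γ]

theorem baseToGen_algebraMap (r : R) :
    baseToGen R Γ (algebraMap R (BaseField R) r) =
      algebraMap (Coeff R Γ) (GenField R Γ) (AddMonoidAlgebra.single 0 r) :=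
  IsFractionRing.lift_algebraMap _ r

variable (R Γ) in
/-- The embedding `F[Γ] → K`. -/
def polyHom : AddMonoidAlgebra (BaseField R) Γ →+* GenField R Γ :=
  AddMonoidAlgebra.liftNCRingHom (baseToGen R Γ)
    { toFun := fun g => eps R g.toAdd
      map_one' := eps_zero
      map_mul' := fun g h => eps_add g.toAdd h.toAdd }
    fun _ _ => Commute.all _ _

theorem polyToGen_eq (a : AddMonoidAlgebra (BaseField R) Γ) : polyToGen a = polyHom R Γ a := by
  rfl

theorem polyHom_single (g : Γ) (r : BaseField R) :
    polyHom R Γ (AddMonoidAlgebra.single g r) = baseToGen R Γ r * eps R g :=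
  AddMonoidAlgebra.liftNC_single _ _ _ _

theorem polyHom_mapRingHom (a : Coeff R Γ) :
    polyHom R Γ (AddMonoidAlgebra.mapRingHom Γ (algebraMap R (BaseField R)) a) =
      algebraMap (Coeff R Γ) (GenField R Γ) a := by
  induction a using AddMonoidAlgebra.induction_linear with
  | zero => simp
  | add a b ha hb => simp only [map_add, ha, hb]
  | single g r =>
    rw [AddMonoidAlgebra.mapRingHom_single, polyHom_single, baseToGen_algebraMap, eps, ← map_mul,
      AddMonoidAlgebra.single_mul_single, zero_add, mul_one]

-- Clears denominators: `K` is built from `R[Γ]`, while leading terms are expressed in `F[Γ]`.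
-- Needed for the injectivity of `F[Γ] → K`.
omit [LinearOrder Γ] [IsOrderedAddMonoid Γ] in
theorem exists_integer_multiple (a : AddMonoidAlgebra (BaseField R) Γ) :
    ∃ (b : R) (c : Coeff R Γ), b ≠ 0 ∧
      AddMonoidAlgebra.mapRingHom Γ (algebraMap R (BaseField R)) c =
        AddMonoidAlgebra.single 0 (algebraMap R (BaseField R) b) * a := by
  induction a using AddMonoidAlgebra.induction_linear with
  | zero => exact ⟨1, 0, one_ne_zero, by simp⟩
  | add a a' ha ha' =>
    obtain ⟨b, c, hb, h⟩ := ha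
    obtain ⟨b', c', hb', h'⟩ := ha'
    refine ⟨b * b', AddMonoidAlgebra.single 0 b' * c + AddMonoidAlgebra.single 0 b * c',
      mul_ne_zero hb hb', ?_⟩
    have hs : (AddMonoidAlgebra.single 0 (algebraMap R (BaseField R) (b * b')) :
        AddMonoidAlgebra (BaseField R) Γ) = AddMonoidAlgebra.single 0 (algebraMap R _ b) *
          AddMonoidAlgebra.single 0 (algebraMap R _ b') := by
      rw [AddMonoidAlgebra.single_mul_single, zero_add, map_mul]
    rw [map_add, map_mul, map_mul, h, h', AddMonoidAlgebra.mapRingHom_single,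
      AddMonoidAlgebra.mapRingHom_single, hs]
    ring
  | single g r =>
    obtain ⟨n, d, hd, rfl⟩ := IsFractionRing.div_surjective (A := R) r
    have hd0 : d ≠ 0 := nonZeroDivisors.ne_zero hd
    refine ⟨d, AddMonoidAlgebra.single g n, hd0, ?_⟩
    rw [AddMonoidAlgebra.mapRingHom_single, AddMonoidAlgebra.single_mul_single, zero_add,
      mul_div_cancel₀]
    exact (map_ne_zero_iff _ (IsFractionRing.injective R (BaseField R))).mpr hd0

theorem polyHom_injective : Function.Injective (polyHom R Γ) := by
  refine (injective_iff_map_eq_zero _).mpr fun a ha => ?_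
  obtain ⟨b, c, hb, h⟩ := exists_integer_multiple a
  have hc : c = 0 := by
    apply IsFractionRing.injective (Coeff R Γ) (GenField R Γ)
    rw [← polyHom_mapRingHom, h, map_mul, ha, mul_zero, map_zero]
  rw [hc, map_zero] at h
  refine (mul_eq_zero.mp h.symm).resolve_left fun h0 => hb ?_
  rw [AddMonoidAlgebra.single_eq_zero] at h0
  exact (map_eq_zero_iff _ (IsFractionRing.injective R (BaseField R))).mp h0

/-- `x = a / b` with `a, b ∈ F[Γ_{≥0}]`, where `b` has constant coefficient `1` and `a` has constant
coefficient `r`. Equivalently, `x ∈ 𝒪` has constant term `r`. -/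
def HasResidue (x : GenField R Γ) (r : BaseField R) : Prop :=
  ∃ a b : AddMonoidAlgebra (BaseField R) Γ, IsNonnegPart a ∧ IsNonnegPart b ∧
    a.coeff 0 = r ∧ b.coeff 0 = 1 ∧ x * polyHom R Γ b = polyHom R Γ a

namespace HasResidue

variable {x y : GenField R Γ} {r s : BaseField R}

/-- Cross-multiply two such fractions inside `F[Γ]` and compare constant coefficients. -/
theorem eq (hr : HasResidue x r) (hs : HasResidue x s) : r = s := by
  obtain ⟨a, b, ha, hb, rfl, hb1, h⟩ := hr
  obtain ⟨a', b', ha', hb', rfl, hb1', h'⟩ := hs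
  have key : a * b' = a' * b := polyHom_injective (by
    rw [map_mul, map_mul, ← h, ← h']
    ring)
  have := congrArg (fun p => p.coeff 0) key
  simpa only [ha.coeff_mul_zero hb', ha'.coeff_mul_zero hb, hb1, hb1', mul_one] using this

theorem add (hx : HasResidue x r) (hy : HasResidue y s) : HasResidue (x + y) (r + s) := by
  obtain ⟨a, b, ha, hb, rfl, hb1, h⟩ := hx
  obtain ⟨a', b', ha', hb', rfl, hb1', h'⟩ := hy
  refine ⟨a * b' + a' * b, b * b', (ha.mul hb').add (ha'.mul hb), hb.mul hb', ?_, ?_, ?_⟩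
  · rw [AddMonoidAlgebra.coeff_add, Finsupp.add_apply, ha.coeff_mul_zero hb',
      ha'.coeff_mul_zero hb, hb1, hb1', mul_one, mul_one]
  · rw [hb.coeff_mul_zero hb', hb1, hb1', mul_one]
  · rw [map_add, map_mul, map_mul, map_mul, ← h, ← h']
    ring

theorem mul (hx : HasResidue x r) (hy : HasResidue y s) : HasResidue (x * y) (r * s) := by
  obtain ⟨a, b, ha, hb, rfl, hb1, h⟩ := hx
  obtain ⟨a', b', ha', hb', rfl, hb1', h'⟩ := hy
  refine ⟨a * a', b * b', ha.mul ha', hb.mul hb', ha.coeff_mul_zero ha', ?_, ?_⟩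
  · rw [hb.coeff_mul_zero hb', hb1, hb1', mul_one]
  · rw [map_mul, map_mul, ← h, ← h']
    ring

theorem of_poly {a : AddMonoidAlgebra (BaseField R) Γ} (ha : IsNonnegPart a) :
    HasResidue (polyHom R Γ a) (a.coeff 0) :=
  ⟨a, 1, ha, IsNonnegPart.single le_rfl 1, rfl, Finsupp.single_eq_same, by simp⟩

theorem base (r : BaseField R) : HasResidue (baseToGen R Γ r) r := by
  have := of_poly (IsNonnegPart.single (le_refl (0 : Γ)) r)
  rwa [polyHom_single, eps_zero, mul_one, AddMonoidAlgebra.coeff_single,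
    Finsupp.single_eq_same] at this

theorem zero : HasResidue (0 : GenField R Γ) 0 := by
  simpa using base (R := R) (Γ := Γ) 0

theorem sum {ι : Type*} (t : Finset ι) {f : ι → GenField R Γ} {c : ι → BaseField R}
    (h : ∀ i ∈ t, HasResidue (f i) (c i)) : HasResidue (∑ i ∈ t, f i) (∑ i ∈ t, c i) := by
  classical
  induction t using Finset.induction_on with
  | empty => simpa using zero
  | insert i t hi ih =>
    rw [Finset.sum_insert hi, Finset.sum_insert hi]
    exact (h i (Finset.mem_insert_self i t)).add
      (ih fun j hj => h j (Finset.mem_insert_of_mem hj))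

theorem one_add_poly {p : AddMonoidAlgebra (BaseField R) Γ} (hp : IsPositivePart p) :
    IsNonnegPart (1 + p) ∧ (1 + p).coeff 0 = 1 := by
  refine ⟨(IsNonnegPart.single le_rfl 1).add fun g hg => (hp g hg).le, ?_⟩
  rw [AddMonoidAlgebra.coeff_add, Finsupp.add_apply, hp.coeff_zero, add_zero]
  exact Finsupp.single_eq_same

theorem polyHom_one_add_ne_zero {p : AddMonoidAlgebra (BaseField R) Γ} (hp : IsPositivePart p) :
    1 + polyHom R Γ p ≠ 0 := fun h => by
  have : (1 + p) = 0 := polyHom_injective (by rw [map_add, map_one, h, map_zero])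
  have h1 := (one_add_poly hp).2
  rw [this] at h1
  exact one_ne_zero h1.symm

/-- The coefficient of the monomial at `0` covers both cases: `r` if `g = 0`, and `0` if `g > 0`. -/
theorem of_hasLeading {g : Γ} (hg : 0 ≤ g) (h : HasLeading x r g) :
    HasResidue x ((AddMonoidAlgebra.single g r).coeff 0) := by
  obtain ⟨p, q, hp, hq, rfl⟩ := h
  have h1 := one_add_poly hp
  have h2 := one_add_poly hq
  have hs := IsNonnegPart.single hg r
  refine ⟨AddMonoidAlgebra.single g r * (1 + p), 1 + q, hs.mul h1.1, h2.1, ?_, h2.2, ?_⟩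
  · rw [hs.coeff_mul_zero h1.1, h1.2, mul_one]
  · have := polyHom_one_add_ne_zero hq
    rw [map_mul, polyHom_single, map_add, map_add, map_one, polyToGen_eq, polyToGen_eq]
    field_simp

theorem of_memO (h : MemO x) : ∃ r, HasResidue x r := by
  rcases h with rfl | ⟨r, g, hg, h⟩
  · exact ⟨0, zero⟩
  · exact ⟨_, of_hasLeading hg h⟩

theorem of_memP (h : MemP x) : HasResidue x 0 := by
  rcases h with rfl | ⟨r, g, hg, h⟩
  · exact zero
  · have := of_hasLeading hg.le h
    rwa [AddMonoidAlgebra.coeff_single, Finsupp.single_eq_of_ne hg.ne] at this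

theorem memP (h : HasResidue x 0) : MemP x := by
  obtain ⟨a, b, ha, hb, ha0, hb1, h⟩ := h
  have hq := hb.isPositivePart_sub_one hb1
  have hb0 := polyHom_one_add_ne_zero hq
  rw [map_sub, map_one, add_sub_cancel] at hb0
  rcases eq_or_ne a 0 with rfl | hne
  · left
    rw [map_zero] at h
    exact (mul_eq_zero.mp h).resolve_right hb0
  right
  have hsupp : a.coeff.support.Nonempty := by
    rwa [Finsupp.support_nonempty_iff, ne_eq, AddMonoidAlgebra.coeff_eq_zero]
  -- The lowest term of the numerator supplies `r_x` and `g_x`. Dividing `a` by it leaves `1 + p`,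
  -- and `b = 1 + q`. The vanishing constant coefficient of `a` forces `g > 0`.
  set g := a.coeff.support.min' hsupp with hgdef
  have hg := a.coeff.support.min'_mem hsupp
  rw [← hgdef] at hg
  have hr : a.coeff g ≠ 0 := Finsupp.mem_support_iff.mp hg
  have hgpos : 0 < g := lt_of_le_of_ne (ha g hg) fun e => hr (e ▸ ha0)
  have hc (k : Γ) : (AddMonoidAlgebra.single (-g) (a.coeff g)⁻¹ * a).coeff k =
      (a.coeff g)⁻¹ * a.coeff (g + k) := by
    rw [AddMonoidAlgebra.coeff_single_mul_apply, neg_neg]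
  have hp := IsNonnegPart.isPositivePart_sub_one (a := AddMonoidAlgebra.single (-g) (a.coeff g)⁻¹ * a)
    (fun k hk => by
      rw [Finsupp.mem_support_iff, hc] at hk
      have := Finset.min'_le _ _ (Finsupp.mem_support_iff.mpr (right_ne_zero_of_mul hk))
      exact le_add_iff_nonneg_right g |>.mp this)
    (by rw [hc, add_zero, inv_mul_cancel₀ hr])
  refine ⟨a.coeff g, g, hgpos, _, _, hp, hq, ?_⟩
  have hbase : baseToGen R Γ (a.coeff g) ≠ 0 := (map_ne_zero _).mpr hr
  have heps : eps R g * eps R (-g) = 1 := by rw [← eps_add, add_neg_cancel, eps_zero]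
  simp only [polyToGen_eq, map_sub, map_one, map_mul, polyHom_single, map_inv₀, add_sub_cancel]
  rw [← mul_div_assoc, eq_div_iff hb0, h]
  calc polyHom R Γ a = (baseToGen R Γ (a.coeff g) * (baseToGen R Γ (a.coeff g))⁻¹) *
        (eps R g * eps R (-g)) * polyHom R Γ a := by
          rw [heps, mul_inv_cancel₀ hbase, one_mul, one_mul]
    _ = _ := by ring

/-- Bridge from the chosen value in `constTerm` to residues: any chosen `r'` with `x - r' ∈ 𝔭` is a
residue of `x`, so uniqueness applies. -/
theorem constTerm_eq (h : HasResidue x r) : constTerm x = r := by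
  have hex : ∃ r : BaseField R, MemP (x - baseToGen R Γ r) := by
    refine ⟨r, memP ?_⟩
    have := h.add (base (Γ := Γ) (-r))
    rwa [map_neg, ← sub_eq_add_neg, ← sub_eq_add_neg, sub_self] at this
  rw [constTerm, dif_pos hex]
  have := (of_memP hex.choose_spec).add (base hex.choose)
  rw [sub_add_cancel, zero_add] at this
  exact this.eq h

end HasResidue

theorem MemO.hasResidue {x : GenField R Γ} (h : MemO x) : HasResidue x (constTerm x) := by
  obtain ⟨r, hr⟩ := HasResidue.of_memO h
  rwa [hr.constTerm_eq]

end Residues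

/-! ### Schur elements, traces and the structure constants. -/

section Main

variable {B W Γ : Type*} [Group W] [Fintype W] [AddCommGroup Γ] [LinearOrder Γ]
  [IsOrderedAddMonoid Γ] {M : CoxeterMatrix B} {cs : CoxeterSystem M W} {R : Type*} [CommRing R]
  [IsDomain R] {L : W → Γ}

section Schur

variable {m n : ℕ} {ρ : MatRep cs R L m} {σ : MatRep cs R L n}

/-- Dualizing swaps the two trace factors in each summand. -/
theorem schurElt_dual (ρ : MatRep cs R L n) : schurElt (MatRep.dual ρ) = schurElt ρ := by
  simp only [schurElt, MatRep.dual_T, Matrix.trace_transpose, inv_inv]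
  congr 1
  exact Finset.sum_congr rfl fun w _ => mul_comm _ _

theorem IsEquivalent.schurElt_eq (h : IsEquivalent ρ σ) : schurElt ρ = schurElt σ := by
  simp only [schurElt, h.trace_eq, h.dim_eq]

/-- The value, chosen or default, depends on the representation only through its Schur element. -/
theorem aInv_congr (h : schurElt ρ = schurElt σ) : aInv ρ = aInv σ := by
  unfold aInv
  rw [h]

theorem fInv_congr (h : schurElt ρ = schurElt σ) : fInv ρ = fInv σ := by
  unfold fInv
  rw [h]

end Schur

theorem MemO.neg_one_pow_mul {x : GenField R Γ} (h : MemO x) (k : ℕ) :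
    HasResidue ((-1) ^ k * x) (constTerm ((-1) ^ k * x)) := by
  have h1 := (HasResidue.base (Γ := Γ) ((-1 : BaseField R) ^ k)).mul h.hasResidue
  rw [map_pow, map_neg, map_one] at h1
  rwa [h1.constTerm_eq]

/-- The matrix `((-1)^{l(w)} ε ^ a ρ(T_w))` of a balanced representation reduces to the matrix of
leading coefficients. -/
theorem IsBalanced.hasResidue {n : ℕ} {ρ : MatRep cs R L n} (hρ : IsBalanced ρ) (w : W)
    (i j : Fin n) :
    HasResidue ((-1) ^ cs.length w * eps R (aInv ρ) * ρ (HeckeK.T cs R L w) i j)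
      (leadCoeff ρ w i j) := by
  rw [leadCoeff, mul_assoc]
  exact (hρ w i j).neg_one_pow_mul _

/-- For a balanced representation, the trace of a triple product of leading coefficient matrices is
determined by the character. -/
theorem IsBalanced.sum_leadCoeff {n : ℕ} {ρ : MatRep cs R L n} (hρ : IsBalanced ρ) (x y z : W) :
    ∑ i, ∑ j, ∑ k, leadCoeff ρ x i j * leadCoeff ρ y j k * leadCoeff ρ z k i =
      constTerm ((-1) ^ (cs.length x + cs.length y + cs.length z) * eps R (aInv ρ) ^ 3 *
        (ρ (HeckeK.T cs R L x) * ρ (HeckeK.T cs R L y) * ρ (HeckeK.T cs R L z)).trace) := by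
  have h := HasResidue.sum Finset.univ fun i _ => HasResidue.sum Finset.univ fun j _ =>
    HasResidue.sum Finset.univ fun k _ =>
      ((hρ.hasResidue x i j).mul (hρ.hasResidue y j k)).mul (hρ.hasResidue z k i)
  rw [← h.constTerm_eq]
  congr 1
  simp only [Matrix.trace, Matrix.diag_apply, Matrix.mul_apply, Finset.mul_sum, Finset.sum_mul]
  refine Finset.sum_congr rfl fun i _ => ?_
  rw [Finset.sum_comm]
  refine Finset.sum_congr rfl fun j _ => Finset.sum_congr rfl fun k _ => ?_
  ring

/-- The contribution of an irreducible representation to `γ̃_{x,y,z}` agrees with that of a balanced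
representation equivalent to the contragredient to `γ̃_{y⁻¹,x⁻¹,z⁻¹}`. -/
theorem IsEquivalent.sum_leadCoeff_dual {m n : ℕ} {ρ : MatRep cs R L m} {σ : MatRep cs R L n}
    (h : IsEquivalent (MatRep.dual ρ) σ) (hρ : IsBalanced ρ) (hσ : IsBalanced σ) (x y z : W) :
    ∑ i, ∑ j, ∑ k, (fInv ρ)⁻¹ * leadCoeff ρ x i j * leadCoeff ρ y j k * leadCoeff ρ z k i =
      ∑ i, ∑ j, ∑ k, (fInv σ)⁻¹ * leadCoeff σ y⁻¹ i j * leadCoeff σ x⁻¹ j k *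
        leadCoeff σ z⁻¹ k i := by
  have hs : schurElt ρ = schurElt σ := by rw [← schurElt_dual, h.schurElt_eq]
  have ht : (ρ (HeckeK.T cs R L x) * ρ (HeckeK.T cs R L y) * ρ (HeckeK.T cs R L z)).trace =
      (σ (HeckeK.T cs R L y⁻¹) * σ (HeckeK.T cs R L x⁻¹) * σ (HeckeK.T cs R L z⁻¹)).trace := by
    -- Transposition turns the right-hand product into the order `z, x, y`, a cyclic rotation of `x,
    -- y, z`.
    rw [← map_mul σ, ← map_mul σ, ← h.trace_eq, map_mul, map_mul, MatRep.dual_T, MatRep.dual_T,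
      MatRep.dual_T, inv_inv, inv_inv, inv_inv, ← Matrix.transpose_mul, ← Matrix.transpose_mul,
      Matrix.trace_transpose, Matrix.trace_mul_comm]
  simp only [mul_assoc (fInv _)⁻¹, ← Finset.mul_sum]
  rw [hρ.sum_leadCoeff, hσ.sum_leadCoeff, ht, fInv_congr hs, aInv_congr hs, cs.length_inv,
    cs.length_inv, cs.length_inv, add_comm (cs.length y)]

variable {Λ : Type*} {d : Λ → ℕ} {ρ : ∀ l, MatRep cs R L (d l)}

omit [Fintype W] in
/-- Taking contragredients permutes the irreducible representations. -/
theorem IsCompleteFamily.exists_dual_perm [Finite Λ] (hρ : IsCompleteFamily ρ) :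
    ∃ e : Λ ≃ Λ, ∀ l, IsEquivalent (MatRep.dual (ρ l)) (ρ (e l)) := by
  choose e he using fun l => hρ.exhaustive _ _ (hρ.irred l).dual
  -- If two duals are equivalent to the same member, dualizing again makes the originals equivalent.
  have hinj : Function.Injective e := fun l l' hll => by
    have h := ((he l).trans (hll ▸ (he l').symm)).dual
    rw [MatRep.dual_dual, MatRep.dual_dual] at h
    exact hρ.inequivalent l l' h
  exact ⟨Equiv.ofBijective e (Finite.injective_iff_bijective.mp hinj), he⟩

variable [Fintype Λ]

theorem gammaTilde_inv (hρ : IsCompleteFamily ρ) (hbal : ∀ l, IsBalanced (ρ l)) (x y z : W) :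
    gammaTilde ρ x y z = gammaTilde ρ y⁻¹ x⁻¹ z⁻¹ := by
  obtain ⟨e, he⟩ := hρ.exists_dual_perm
  rw [gammaTilde, gammaTilde]
  refine Eq.trans ?_ (e.sum_comp _)
  exact Finset.sum_congr rfl fun l _ => (he l).sum_leadCoeff_dual (hbal l) (hbal (e l)) x y z

omit [Fintype W] in
theorem jFlip_tBasis (w : W) : jFlip W R (tBasis R w) = tBasis R w⁻¹ := by
  rw [jFlip, tBasis, Finsupp.linearCombination_single, one_smul]

theorem jMul_tBasis (x y : W) :
    jMul ρ (tBasis R x) (tBasis R y) = ∑ z : W, gammaTilde ρ x y z⁻¹ • tBasis R z := by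
  simp only [jMul, tBasis, Finsupp.linearCombination_single, one_smul]

omit [Fintype W] in
theorem jFlip_jFlip (a : JTilde W R) : jFlip W R (jFlip W R a) = a := by
  have h : (jFlip W R).comp (jFlip W R) = LinearMap.id := by
    refine Finsupp.lhom_ext' fun w => LinearMap.ext_ring ?_
    change jFlip W R (jFlip W R (tBasis R w)) = tBasis R w
    rw [jFlip_tBasis, jFlip_tBasis, inv_inv]
  exact LinearMap.congr_fun h a

/-- By bilinearity it suffices to compare basis elements, where the substitution `z ↦ z⁻¹` matches
the coefficients. -/
theorem jFlip_jMul (h : ∀ x y z, gammaTilde ρ x y z = gammaTilde ρ y⁻¹ x⁻¹ z⁻¹)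
    (a b : JTilde W R) :
    jFlip W R (jMul ρ a b) = jMul ρ (jFlip W R b) (jFlip W R a) := by
  have key : (jMul ρ).compr₂ (jFlip W R) = (jMul ρ).flip.compl₁₂ (jFlip W R) (jFlip W R) := by
    refine Finsupp.lhom_ext' fun x => LinearMap.ext_ring <|
      Finsupp.lhom_ext' fun y => LinearMap.ext_ring ?_
    change jFlip W R (jMul ρ (tBasis R x) (tBasis R y)) =
      jMul ρ (jFlip W R (tBasis R y)) (jFlip W R (tBasis R x))
    rw [jFlip_tBasis, jFlip_tBasis, jMul_tBasis, jMul_tBasis, map_sum,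
      ← Equiv.sum_comp (Equiv.inv W) fun z => gammaTilde ρ y⁻¹ x⁻¹ z⁻¹ • tBasis R z]
    refine Finset.sum_congr rfl fun z _ => ?_
    rw [map_smul, jFlip_tBasis, h x y, Equiv.inv_apply]
  exact LinearMap.congr_fun₂ key a b

end Main

end

end GeckHecke

theorem proposition3p8
    {B W Γ Λ : Type*} [Group W] [Fintype W] {M : CoxeterMatrix B} (cs : CoxeterSystem M W)
    [AddCommGroup Γ] [LinearOrder Γ] [IsOrderedAddMonoid Γ]
    (L : W → Γ) (hL : GeckHecke.IsWeightFunction cs L) (hLpos : ∀ i : B, 0 < L (cs.simple i))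
    (R : Subring ℂ) (hR : GeckHecke.cosRing cs ≤ R)
    [Fintype Λ] (d : Λ → ℕ) (ρ : ∀ l : Λ, GeckHecke.MatRep cs R L (d l))
    (hρ : GeckHecke.IsCompleteFamily ρ) (hbal : ∀ l : Λ, GeckHecke.IsBalanced (ρ l)) :
    (∀ a : GeckHecke.JTilde W R, GeckHecke.jFlip W R (GeckHecke.jFlip W R a) = a) ∧
    (∀ a b : GeckHecke.JTilde W R,
      GeckHecke.jFlip W R (GeckHecke.jMul ρ a b) =
        GeckHecke.jMul ρ (GeckHecke.jFlip W R b) (GeckHecke.jFlip W R a)) ∧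
    (∀ x y z : W, GeckHecke.gammaTilde ρ x y z = GeckHecke.gammaTilde ρ y⁻¹ x⁻¹ z⁻¹) := by

  have h := GeckHecke.gammaTilde_inv hρ hbal
  exact ⟨GeckHecke.jFlip_jFlip, GeckHecke.jFlip_jMul h, h⟩
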